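/- Let $\varkappa\ge 1$ be an integer and let $\mathbb T^\varkappa$ be the $\varkappa$-dimensional torus. A trigonometric polynomial is a function $p\colon\mathbb T^\varkappa\to\mathbb C$ of the form $p(z)=\sum_{\alpha\in\mathbb Z^\varkappa}a_\alpha z^\alpha$ with only finitely many nonzero coefficients $a_\alpha\in\mathbb C$ (these are uniquely determined by $p$), where $z^\alpha=z_1^{\alpha_1}\cdots z_\varkappa^{\alpha_\varkappa}$; it is called analytic if $a_\alpha=0$ for all $\alpha\notin\mathbb Z_+^\varkappa$, where $\mathbb Z_+=\{0,1,2,\dots\}$. For $T\subset\mathbb Z^\varkappa$, let $\mathcal P_T(\mathbb T^\varkappa)$ be the complex linear space of all trigonometric polynomials with $a_\alpha=0$ for all $\alpha\in\mathbb Z^\varkappa\setminus T$. Let $\mathscr P_T^+(\mathbb T^\varkappa)$ be the set of all $q\in\mathcal P_T(\mathbb T^\varkappa)$ with $q(z)\ge 0$ for all $z\in\mathbb T^\varkappa$, and let $\varSigma_T^2(\mathbb T^\varkappa)$ be the set of all $q\in\mathcal P_T(\mathbb T^\varkappa)$ for which there exist finitely many analytic trigonometric polynomials $q_1,\dots,q_k$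 (not required to lie in $\mathcal P_T(\mathbb T^\varkappa)$) such that $q(z)=\sum_{j=1}^k|q_j(z)|^2$ for all $z\in\mathbb T^\varkappa$. Proposition. Let $T\subset\mathbb Z^\varkappa$ be such that $0\in T=-T$. Then $\varSigma_T^2(\mathbb T^\varkappa)$ is a dense subset of $\mathscr P_T^+(\mathbb T^\varkappa)$ with respect to the finest locally convex topology on $\mathcal P_T(\mathbb T^\varkappa)$, i.e. the topology given by the family of all seminorms on $\mathcal P_T(\mathbb T^\varkappa)$. In particular, this is also the case for the topology of uniform convergence on $\mathbb T^\varkappa$ and for the topology given by the norm $\|p\|'_{\mathrm{co}}=\max_{\alpha\in\mathbb Z^\varkappa}|a_\alpha|$. -/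

import Mathlib

open scoped Topology Pointwise ComplexOrder

noncomputable section

namespace TrigApprox

/-- The torus `𝕋^κ`. -/
abbrev Torus (κ : ℕ) : Type := Fin κ → Circle

/-- The function `z ↦ z^α = z₁^{α₁} ⋯ z_κ^{α_κ}` on the torus. -/
def monomial {κ : ℕ} (α : Fin κ → ℤ) : Torus κ → ℂ :=
  fun z => ∏ i, (z i : ℂ) ^ α i

/-- The map sending a finite system of coefficients `a` to the function `z ↦ ∑ a_α z^α`. -/
def evalCoeffs (κ : ℕ) : ((Fin κ → ℤ) →₀ ℂ) →ₗ[ℂ] (Torus κ → ℂ) :=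
  Finsupp.linearCombination ℂ monomial

/-- The space `𝒫(𝕋^κ)` of trigonometric polynomials, as functions on the torus. -/
def TrigPoly (κ : ℕ) : Submodule ℂ (Torus κ → ℂ) :=
  LinearMap.range (evalCoeffs κ)

theorem evalCoeffs_apply {κ : ℕ} (a : (Fin κ → ℤ) →₀ ℂ) (z : Torus κ) :
    evalCoeffs κ a z = a.sum fun α c => c * ∏ i, (z i : ℂ) ^ α i := by
  simp [evalCoeffs, Finsupp.linearCombination_apply, Finsupp.sum, monomial]

theorem monomial_linearIndependent (κ : ℕ) :
    LinearIndependent ℂ (monomial : (Fin κ → ℤ) → Torus κ → ℂ) := by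
  let φ : (Fin κ → ℤ) → (Torus κ →* ℂ) := fun α =>
    { toFun := monomial α
      map_one' := by simp [monomial]
      map_mul' := fun z w => by simp [monomial, mul_zpow, Finset.prod_mul_distrib] }
  have hφ : Function.Injective φ := by
    intro α β h
    funext i
    have h1 := DFunLike.congr_fun h (Function.update (1 : Torus κ) i (Circle.exp 1))
    have key : ∀ γ : Fin κ → ℤ, φ γ (Function.update 1 i (Circle.exp 1)) =
        Complex.exp (γ i * Complex.I) := by
      intro γ
      change ∏ j, ((Function.update (1 : Torus κ) i (Circle.exp 1) j : Circle) : ℂ) ^ γ j = _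
      rw [Finset.prod_eq_single i]
      · simp [← Complex.exp_int_mul]
      · intro j _ hj
        simp [Function.update_of_ne hj]
      · simp
    rw [key, key, Complex.exp_eq_exp_iff_exists_int] at h1
    obtain ⟨n, hn⟩ := h1
    have h2 : ((α i : ℂ)) = β i + n * (2 * Real.pi) := by
      apply mul_right_cancel₀ Complex.I_ne_zero
      rw [hn]; ring
    have h3 : ((α i : ℝ)) = β i + n * (2 * Real.pi) := by exact_mod_cast h2
    have hn0 : n = 0 := by
      by_contra hne
      apply irrational_pi
      refine ⟨((α i - β i : ℤ) : ℚ) / ((2 * n : ℤ) : ℚ), ?_⟩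
      have : (n : ℝ) ≠ 0 := by exact_mod_cast hne
      push_cast
      rw [div_eq_iff (by positivity)]
      linarith
    subst hn0
    simpa using h3
  exact (linearIndependent_monoidHom (Torus κ) ℂ).comp φ hφ

/-- The coefficients `(a_α)` of a trigonometric polynomial (they are uniquely determined). -/
def coeff (κ : ℕ) : TrigPoly κ ≃ₗ[ℂ] ((Fin κ → ℤ) →₀ ℂ) :=
  (LinearEquiv.ofInjective (evalCoeffs κ) (monomial_linearIndependent κ)).symm

theorem evalCoeffs_coeff {κ : ℕ} (p : TrigPoly κ) :
    evalCoeffs κ (coeff κ p) = (p : Torus κ → ℂ) :=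
  congrArg Subtype.val
    ((LinearEquiv.ofInjective (evalCoeffs κ) (monomial_linearIndependent κ)).apply_symm_apply p)

/-- `𝒫_T(𝕋^κ)`: the trigonometric polynomials whose coefficients vanish outside `T`. -/
def TrigPolyOn {κ : ℕ} (T : Set (Fin κ → ℤ)) : Submodule ℂ (TrigPoly κ) where
  carrier := {p | ∀ α, α ∉ T → coeff κ p α = 0}
  zero_mem' := by simp
  add_mem' := by
    intro p q hp hq α hα
    simp [hp α hα, hq α hα]
  smul_mem' := by
    intro c p hp α hα
    simp [hp α hα]

/-- `𝒫₊(𝕋^κ)`: the analytic trigonometric polynomials. -/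
def AnalyticTrigPoly (κ : ℕ) : Submodule ℂ (TrigPoly κ) :=
  TrigPolyOn {α | ∀ i, 0 ≤ α i}

/-- The members of `𝒫_T(𝕋^κ)` that are finite sums of squares of moduli of analytic
trigonometric polynomials. -/
def sumsOfSquares {κ : ℕ} (T : Set (Fin κ → ℤ)) : Set (TrigPolyOn T) :=
  {q | ∃ (k : ℕ) (g : Fin k → AnalyticTrigPoly κ),
    ∀ z : Torus κ, q.1.1 z = ∑ j, ((‖(g j).1.1 z‖ ^ 2 : ℝ) : ℂ)}

/-- The members of `𝒫_T(𝕋^κ)` that are (real and) nonnegative on the torus. -/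
def nonnegOn {κ : ℕ} (T : Set (Fin κ → ℤ)) : Set (TrigPolyOn T) :=
  {q | ∀ z : Torus κ, 0 ≤ q.1.1 z}

/-- The locally convex topology on `V` given by a family of seminorms. -/
abbrev seminormTopology {V ι : Type*} [AddCommGroup V] [Module ℂ V] [Nonempty ι]
    (p : ι → Seminorm ℂ V) : TopologicalSpace V :=
  (SeminormFamily.moduleFilterBasis (𝕜 := ℂ) p).topology

theorem seminormTopology_withSeminorms {V ι : Type*} [AddCommGroup V] [Module ℂ V] [Nonempty ι]
    (p : SeminormFamily ℂ V ι) : @WithSeminorms ℂ V ι _ _ _ p (seminormTopology p) :=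
  letI := seminormTopology p
  ⟨rfl⟩

/-- The finest locally convex topology, given by all seminorms on `V`. -/
abbrev finestLocallyConvex (V : Type*) [AddCommGroup V] [Module ℂ V] : TopologicalSpace V :=
  seminormTopology (fun p : Seminorm ℂ V => p)

/-- The topology on `𝒫_T(𝕋^κ)` of uniform convergence on the torus. -/
abbrev uniformTopology {κ : ℕ} (T : Set (Fin κ → ℤ)) : TopologicalSpace (TrigPolyOn T) :=
  TopologicalSpace.induced
    (fun q : TrigPolyOn T => UniformFun.ofFun (q.1.1 : Torus κ → ℂ)) inferInstance

/-- The coefficient-max norm `‖p‖ = max_α |a_α|`. -/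
def coeffNorm (κ : ℕ) : Seminorm ℂ (TrigPoly κ) :=
  Seminorm.of
    (fun p => (((coeff κ p).support.sup fun α => ‖coeff κ p α‖₊ : NNReal) : ℝ))
    (by
      intro p q
      rw [← NNReal.coe_add, NNReal.coe_le_coe]
      have h : ∀ (r : TrigPoly κ) (α : Fin κ → ℤ),
          ‖coeff κ r α‖₊ ≤ (coeff κ r).support.sup fun α => ‖coeff κ r α‖₊ := by
        intro r α
        by_cases hα : α ∈ (coeff κ r).support
        · exact Finset.le_sup (f := fun α => ‖coeff κ r α‖₊) hα
        · simp [Finsupp.notMem_support_iff.mp hα]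
      refine Finset.sup_le fun α _ => ?_
      rw [map_add, Finsupp.add_apply]
      exact (nnnorm_add_le _ _).trans (add_le_add (h p α) (h q α)))
    (by
      intro c p
      rcases eq_or_ne c 0 with rfl | hc
      · simp
      · rw [← coe_nnnorm, ← NNReal.coe_mul, NNReal.coe_inj, NNReal.mul_finset_sup, map_smul,
          Finsupp.support_smul_eq hc]
        simp)

theorem coeffNorm_eq_zero {κ : ℕ} {p : TrigPoly κ} (h : coeffNorm κ p = 0) : p = 0 := by
  have h1 : (coeff κ p).support.sup (fun α => ‖coeff κ p α‖₊) = 0 := NNReal.coe_eq_zero.mp h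
  apply (coeff κ).injective
  rw [map_zero]
  ext α
  by_cases hα : α ∈ (coeff κ p).support
  · have h2 := Finset.le_sup (f := fun α => ‖coeff κ p α‖₊) hα
    rw [h1] at h2
    simpa using h2
  · simpa using hα

/-- The topology on `𝒫_T(𝕋^κ)` given by the coefficient-max norm. -/
abbrev coeffNormTopology {κ : ℕ} (T : Set (Fin κ → ℤ)) : TopologicalSpace (TrigPolyOn T) :=
  seminormTopology (fun _ : Unit => (coeffNorm κ).comp (TrigPolyOn T).subtype)

/-- `A` is a dense subset of `B` with respect to the topology `τ`. -/
def IsDenseIn {V : Type*} (τ : TopologicalSpace V) (A B : Set V) : Prop :=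
  A ⊆ B ∧ B ⊆ closure[τ] A

end TrigApprox

end

open Filter Finset

namespace TrigApprox

/-! ### The discretised Fejér kernel in one variable -/

/-! Fejér means prove density. The `N`-th mean of `q` multiplies each coefficient by `∏ (1 - |α i| /
N)`, so it stays in `𝒫_T` and tends to `q` along finitely many fixed terms, hence in every vector
space topology. For large `N` the convolution with the Fejér kernel is a finite sum over the grid of
`2N`-th roots of unity (`discrete_fejer`, `fejerMean_apply`). Each summand is a value of `q`,
nonnegative by assumption, times the squared modulus of a product of analytic geometric sums, so the
mean is a sum of squares. -/

theorem sum_primitiveRoot_zpow {M : ℕ} {ζ : ℂ} (hζ : IsPrimitiveRoot ζ M) (m : ℤ) :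
    ∑ k : Fin M, (ζ ^ (k : ℕ)) ^ m = if (M : ℤ) ∣ m then (M : ℂ) else 0 := by
  have h1 : ∑ k : Fin M, (ζ ^ (k : ℕ)) ^ m = ∑ k ∈ range M, (ζ ^ m) ^ k := by
    rw [← Fin.sum_univ_eq_sum_range (fun k => (ζ ^ m) ^ k)]
    refine sum_congr rfl fun k _ => ?_
    rw [← zpow_natCast, ← zpow_natCast, zpow_comm]
  rw [h1]
  split_ifs with h
  · simp [(hζ.zpow_eq_one_iff_dvd m).2 h]
  · have h2 : ζ ^ m ≠ 1 := fun h' => h ((hζ.zpow_eq_one_iff_dvd m).1 h')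
    have h3 : (ζ ^ m) ^ M = 1 := by
      rw [← zpow_natCast, zpow_comm, zpow_natCast, hζ.pow_eq_one, one_zpow]
    rw [geom_sum_eq h2, h3, sub_self, zero_div]

theorem norm_sq_geom_sum (N : ℕ) (x : Circle) :
    ((‖∑ b : Fin N, (x : ℂ) ^ (b : ℕ)‖ ^ 2 : ℝ) : ℂ) =
      ∑ b ∈ range N, ∑ c ∈ range N, (x : ℂ) ^ ((b : ℤ) - c) := by
  rw [Fin.sum_univ_eq_sum_range (fun b => (x : ℂ) ^ b), Complex.ofReal_pow, ← Complex.mul_conj',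
    map_sum, sum_mul_sum]
  refine sum_congr rfl fun b _ => sum_congr rfl fun c _ => ?_
  rw [map_pow, ← Circle.coe_inv_eq_conj, zpow_sub₀ (Circle.coe_ne_zero x)]
  simp [div_eq_mul_inv]

theorem sum_ite_eq_add (N n : ℕ) (hn : n < N) :
    ∑ c ∈ range N, ∑ b ∈ range N, (if b = c + n then (1 : ℂ) else 0) = N - n := by
  have h : ∀ c, ∑ b ∈ range N, (if b = c + n then (1 : ℂ) else 0) =
      if c ∈ range (N - n) then 1 else 0 := by
    intro c
    rw [sum_ite_eq']
    congr 1
    simp only [mem_range, eq_iff_iff]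
    omega
  rw [sum_congr rfl fun c _ => h c, sum_ite_mem,
    inter_eq_right.2 (range_subset_range.2 (Nat.sub_le N n))]
  simp [Nat.cast_sub hn.le]

theorem card_differences (N : ℕ) (a : ℤ) (ha : |a| < N) :
    ∑ b ∈ range N, ∑ c ∈ range N, (if a = (b : ℤ) - c then (1 : ℂ) else 0) =
      N - ((|a| : ℤ) : ℂ) := by
  obtain ⟨n, rfl | rfl⟩ := a.eq_nat_or_neg
  · rw [sum_comm]
    simp only [Nat.abs_cast, Nat.cast_lt, Int.cast_natCast] at ha ⊢
    rw [← sum_ite_eq_add N n ha]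
    refine sum_congr rfl fun c _ => sum_congr rfl fun b _ => ?_
    congr 1
    simp only [eq_iff_iff]
    omega
  · simp only [abs_neg, Nat.abs_cast, Nat.cast_lt, Int.cast_natCast] at ha ⊢
    rw [← sum_ite_eq_add N n ha]
    refine sum_congr rfl fun c _ => sum_congr rfl fun b _ => ?_
    congr 1
    simp only [eq_iff_iff]
    omega

/-- Expanding the square gives frequencies `b - c`; orthogonality of characters on the grid keeps
only the `N - |a|` pairs with `b - c = a`. -/
theorem discrete_fejer {N : ℕ} {ω : Circle} (hω : IsPrimitiveRoot (ω : ℂ) (2 * N))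
    (a : ℤ) (ha : |a| < N) (z : Circle) :
    ∑ k : Fin (2 * N), ((ω ^ (k : ℕ) : Circle) : ℂ) ^ a *
        ((‖∑ b : Fin N, ((z / ω ^ (k : ℕ) : Circle) : ℂ) ^ (b : ℕ)‖ ^ 2 : ℝ) : ℂ) =
      (2 * N) * (N - ((|a| : ℤ) : ℂ)) * (z : ℂ) ^ a := by
  have hz := Circle.coe_ne_zero z
  simp only [norm_sq_geom_sum, mul_sum]
  rw [sum_comm]
  have inner : ∀ b ∈ range N, ∀ c ∈ range N,
      ∑ k : Fin (2 * N), ((ω ^ (k : ℕ) : Circle) : ℂ) ^ a *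
        ((z / ω ^ (k : ℕ) : Circle) : ℂ) ^ ((b : ℤ) - c) =
      (2 * N) * (z : ℂ) ^ a * (if a = (b : ℤ) - c then (1 : ℂ) else 0) := by
    intro b hb c hc
    have h1 : ∀ k : Fin (2 * N), ((ω ^ (k : ℕ) : Circle) : ℂ) ^ a *
        ((z / ω ^ (k : ℕ) : Circle) : ℂ) ^ ((b : ℤ) - c) =
        (z : ℂ) ^ ((b : ℤ) - c) * ((ω : ℂ) ^ (k : ℕ)) ^ (a - ((b : ℤ) - c)) := by
      intro k
      have hk : ((ω : ℂ) ^ (k : ℕ)) ≠ 0 := pow_ne_zero _ (Circle.coe_ne_zero ω)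
      rw [zpow_sub₀ hk, Circle.coe_div, Circle.coe_pow, div_zpow]
      ring
    rw [sum_congr rfl fun k _ => h1 k, ← mul_sum, sum_primitiveRoot_zpow hω]
    -- No aliasing: `|a|` and `|b - c|` are both below `N`, so their difference is below `2N` in
    -- modulus. This is why the grid has `2N` points per variable.
    have h2 : ((2 * N : ℕ) : ℤ) ∣ a - ((b : ℤ) - c) ↔ a = (b : ℤ) - c := by
      constructor
      · intro h
        rw [mem_range] at hb hc
        rw [abs_lt] at ha
        refine sub_eq_zero.1 (Int.eq_zero_of_abs_lt_dvd h ?_)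
        rw [abs_lt]
        push_cast
        omega
      · rintro rfl
        simp
    simp only [h2]
    split_ifs with h
    · rw [h]; push_cast; ring
    · simp
  have h3 : ∀ b ∈ range N, ∑ k : Fin (2 * N), ∑ c ∈ range N, ((ω ^ (k : ℕ) : Circle) : ℂ) ^ a *
        ((z / ω ^ (k : ℕ) : Circle) : ℂ) ^ ((b : ℤ) - c) =
      ∑ c ∈ range N, (2 * N) * (z : ℂ) ^ a * (if a = (b : ℤ) - c then (1 : ℂ) else 0) := by
    intro b hb
    rw [sum_comm]
    exact sum_congr rfl fun c hc => inner b hb c hc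
  rw [sum_congr rfl h3]
  simp only [← mul_sum]
  rw [card_differences N a ha]
  ring

/-! ### Monomials as trigonometric polynomials -/

/-- The monomial `z^α` as a trigonometric polynomial. -/
noncomputable def trigMonomial {κ : ℕ} (α : Fin κ → ℤ) : TrigPoly κ :=
  (coeff κ).symm (Finsupp.single α 1)

theorem coeff_trigMonomial {κ : ℕ} (α : Fin κ → ℤ) :
    coeff κ (trigMonomial α) = Finsupp.single α 1 :=
  (coeff κ).apply_symm_apply _

theorem trigMonomial_apply {κ : ℕ} (α : Fin κ → ℤ) (z : Torus κ) :
    (trigMonomial α).1 z = ∏ i, (z i : ℂ) ^ α i := by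
  rw [← evalCoeffs_coeff, coeff_trigMonomial, evalCoeffs_apply]
  simp

theorem trigMonomial_mem {κ : ℕ} {T : Set (Fin κ → ℤ)} {α : Fin κ → ℤ} (h : α ∈ T) :
    trigMonomial α ∈ TrigPolyOn T := by
  intro β hβ
  rw [coeff_trigMonomial, Finsupp.single_apply_eq_zero]
  rintro rfl
  exact absurd h hβ

theorem trigPoly_apply {κ : ℕ} (q : TrigPoly κ) (z : Torus κ) :
    q.1 z = ∑ α ∈ (coeff κ q).support, coeff κ q α * ∏ i, (z i : ℂ) ^ α i := by
  rw [← evalCoeffs_coeff, evalCoeffs_apply]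
  rfl

theorem mem_of_mem_support {κ : ℕ} {T : Set (Fin κ → ℤ)} (q : TrigPolyOn T) {α : Fin κ → ℤ}
    (h : α ∈ (coeff κ q.1).support) : α ∈ T := by
  by_contra hα
  exact Finsupp.mem_support_iff.1 h (q.2 α hα)

/-- The term `a_α z^α` of a member of `𝒫_T(𝕋^κ)`. -/
noncomputable def term {κ : ℕ} {T : Set (Fin κ → ℤ)} (q : TrigPolyOn T)
    (α : (coeff κ q.1).support) : TrigPolyOn T :=
  coeff κ q.1 α • ⟨trigMonomial α.1, trigMonomial_mem (mem_of_mem_support q α.2)⟩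

theorem term_apply {κ : ℕ} {T : Set (Fin κ → ℤ)} (q : TrigPolyOn T)
    (α : (coeff κ q.1).support) (z : Torus κ) :
    (term q α).1.1 z = coeff κ q.1 α * ∏ i, (z i : ℂ) ^ α.1 i := by
  rw [← trigMonomial_apply]
  rfl

theorem trigPolyOn_sum_apply {κ : ℕ} {T : Set (Fin κ → ℤ)} {ι : Type*} (s : Finset ι)
    (f : ι → TrigPolyOn T) (z : Torus κ) :
    (∑ j ∈ s, f j).1.1 z = ∑ j ∈ s, (f j).1.1 z := by
  simp [Finset.sum_apply]

theorem sum_term {κ : ℕ} {T : Set (Fin κ → ℤ)} (q : TrigPolyOn T) : ∑ α, term q α = q := by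
  apply Subtype.ext
  apply Subtype.ext
  funext z
  rw [trigPolyOn_sum_apply, trigPoly_apply, ← sum_coe_sort (coeff κ q.1).support]
  exact sum_congr rfl fun α _ => term_apply q α z

/-! ### Fejér means -/

/-- The coefficient of `z^α` in the `N`-th Fejér kernel. -/
noncomputable def fejerCoeff {κ : ℕ} (N : ℕ) (α : Fin κ → ℤ) : ℂ :=
  ∏ i, (1 - ((|α i| : ℤ) : ℂ) / N)

theorem tendsto_fejerCoeff {κ : ℕ} (α : Fin κ → ℤ) :
    Tendsto (fun N => fejerCoeff N α) atTop (𝓝 1) := by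
  have h : Tendsto (fun N : ℕ => ∏ i, (1 - ((|α i| : ℤ) : ℂ) / N)) atTop
      (𝓝 (∏ _ : Fin κ, (1 - 0 : ℂ))) := by
    refine tendsto_finsetProd _ fun i _ => tendsto_const_nhds.sub ?_
    exact tendsto_const_div_atTop_nhds_zero_nat _
  simpa [fejerCoeff] using h

/-- The `N`-th Fejér mean of a trigonometric polynomial. -/
noncomputable def fejerMean {κ : ℕ} {T : Set (Fin κ → ℤ)} (q : TrigPolyOn T) (N : ℕ) : TrigPolyOn T :=
  ∑ α, fejerCoeff N α.1 • term q α

theorem tendsto_fejerMean {κ : ℕ} {T : Set (Fin κ → ℤ)} [TopologicalSpace (TrigPolyOn T)]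
    [ContinuousAdd (TrigPolyOn T)] [ContinuousSMul ℂ (TrigPolyOn T)] (q : TrigPolyOn T) :
    Tendsto (fejerMean q) atTop (𝓝 q) := by
  have h : Tendsto (fejerMean q) atTop (𝓝 (∑ α, (1 : ℂ) • term q α)) :=
    tendsto_finsetSum _ fun α _ => (tendsto_fejerCoeff α.1).smul_const _
  simpa only [one_smul, sum_term] using h

/-- The product of the Dirichlet-type sums `∑_{b < N} (z_i / w_i)^b`, scaled by `c`. -/
noncomputable def dirichletProd {κ : ℕ} (N : ℕ) (c : ℂ) (w : Torus κ) : AnalyticTrigPoly κ :=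
  ∑ β : Fin κ → Fin N, (c * ∏ i, ((w i : ℂ) ^ (β i : ℕ))⁻¹) •
    ⟨trigMonomial fun i => ((β i : ℕ) : ℤ), trigMonomial_mem fun _ => Int.natCast_nonneg _⟩

theorem dirichletProd_apply {κ : ℕ} (N : ℕ) (c : ℂ) (w z : Torus κ) :
    (dirichletProd N c w).1.1 z =
      c * ∏ i, ∑ b : Fin N, ((z i / w i : Circle) : ℂ) ^ (b : ℕ) := by
  rw [Finset.prod_univ_sum, Fintype.piFinset_univ, mul_sum]
  refine (trigPolyOn_sum_apply _ _ z).trans (sum_congr rfl fun β _ => ?_)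
  change (c * ∏ i, ((w i : ℂ) ^ (β i : ℕ))⁻¹) * (trigMonomial fun i => ((β i : ℕ) : ℤ)).1 z = _
  rw [trigMonomial_apply, mul_assoc, ← prod_mul_distrib]
  congr 1
  refine prod_congr rfl fun i _ => ?_
  rw [zpow_natCast, Circle.coe_div, div_pow]
  ring

/-- By linearity it suffices to treat one monomial, where the sum over the grid factors into
one-variable sums. -/
theorem fejerMean_apply {κ : ℕ} {T : Set (Fin κ → ℤ)} (q : TrigPolyOn T) (N : ℕ) {ω : Circle}
    (hN : N ≠ 0) (hω : IsPrimitiveRoot (ω : ℂ) (2 * N))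
    (h : ∀ α ∈ (coeff κ q.1).support, ∀ i, |α i| < N) (z : Torus κ) :
    (fejerMean q N).1.1 z = ∑ k : Fin κ → Fin (2 * N),
      q.1.1 (fun i => ω ^ (k i : ℕ)) * ((2 * N * N : ℂ)⁻¹ ^ κ *
        ∏ i, ((‖∑ b : Fin N, ((z i / ω ^ (k i : ℕ) : Circle) : ℂ) ^ (b : ℕ)‖ ^ 2 : ℝ) : ℂ)) := by
  have hN' : (N : ℂ) ≠ 0 := Nat.cast_ne_zero.2 hN
  simp only [trigPoly_apply q.1, sum_mul]
  rw [sum_comm, ← sum_coe_sort, fejerMean, trigPolyOn_sum_apply]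
  refine sum_congr rfl fun α _ => ?_
  change fejerCoeff N α.1 * (term q α).1.1 z = _
  have key : ∏ i, ∑ k : Fin (2 * N), ((ω ^ (k : ℕ) : Circle) : ℂ) ^ α.1 i *
        ((‖∑ b : Fin N, ((z i / ω ^ (k : ℕ) : Circle) : ℂ) ^ (b : ℕ)‖ ^ 2 : ℝ) : ℂ) =
      (2 * N * N : ℂ) ^ κ * (fejerCoeff N α.1 * ∏ i, (z i : ℂ) ^ α.1 i) := by
    rw [fejerCoeff, ← prod_mul_distrib, ← Fin.prod_const, ← prod_mul_distrib]
    refine prod_congr rfl fun i _ => ?_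
    rw [discrete_fejer hω _ (h α.1 α.2 i)]
    field_simp
  rw [Finset.prod_univ_sum, Fintype.piFinset_univ] at key
  simp only [prod_mul_distrib] at key
  have hc : (2 * N * N : ℂ)⁻¹ ^ κ * (2 * N * N : ℂ) ^ κ = 1 := by
    rw [← mul_pow, inv_mul_cancel₀ (by simp [hN']), one_pow]
  rw [term_apply]
  calc _ = coeff κ q.1 α.1 * ((2 * N * N : ℂ)⁻¹ ^ κ * ((2 * N * N : ℂ) ^ κ *
        (fejerCoeff N α.1 * ∏ i, (z i : ℂ) ^ α.1 i))) := by
        rw [← mul_assoc ((2 * N * N : ℂ)⁻¹ ^ κ), hc]; ring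
    _ = _ := by
        rw [← key, mul_sum, mul_sum]
        refine sum_congr rfl fun k _ => ?_
        ring

theorem fejerMean_mem_sumsOfSquares {κ : ℕ} {T : Set (Fin κ → ℤ)} {q : TrigPolyOn T}
    (hq : q ∈ nonnegOn T) {N : ℕ} (hN : N ≠ 0)
    (h : ∀ α ∈ (coeff κ q.1).support, ∀ i, |α i| < N) : fejerMean q N ∈ sumsOfSquares T := by
  obtain ⟨ω, hω⟩ : ∃ ω : Circle, IsPrimitiveRoot (ω : ℂ) (2 * N) := by
    refine ⟨Circle.exp (2 * Real.pi / (2 * N : ℕ)), ?_⟩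
    convert Complex.isPrimitiveRoot_exp (2 * N) (by omega) using 1
    rw [Circle.coe_exp]
    congr 1
    push_cast
    ring
  let w : (Fin κ → Fin (2 * N)) → Torus κ := fun k i => ω ^ (k i : ℕ)
  -- The quadrature weight at a node; its square root is absorbed into the analytic polynomial.
  let r : (Fin κ → Fin (2 * N)) → ℝ := fun k => (q.1.1 (w k)).re * (2 * N * N : ℝ)⁻¹ ^ κ
  let e := Fintype.equivFin (Fin κ → Fin (2 * N))
  refine ⟨_, fun j => dirichletProd N (Real.sqrt (r (e.symm j)) : ℂ) (w (e.symm j)), fun z => ?_⟩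
  rw [fejerMean_apply q N hN hω h z, e.symm.sum_comp
    (fun k => ((‖(dirichletProd N (Real.sqrt (r k) : ℂ) (w k)).1.1 z‖ ^ 2 : ℝ) : ℂ))]
  refine sum_congr rfl fun k _ => ?_
  have hr := Complex.nonneg_iff.1 (hq (w k))
  have hr0 : 0 ≤ r k := mul_nonneg hr.1 (by positivity)
  have hre : q.1.1 (w k) = ((q.1.1 (w k)).re : ℂ) := Complex.ext rfl hr.2.symm
  rw [dirichletProd_apply, norm_mul, mul_pow, norm_prod, ← prod_pow, Complex.norm_real,
    Real.norm_of_nonneg (Real.sqrt_nonneg _), Real.sq_sqrt hr0]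
  change q.1.1 (w k) * _ = _
  rw [hre, ← mul_assoc]
  push_cast [r]
  rfl

/-! ### Density in the various topologies -/

theorem sumsOfSquares_subset_nonnegOn {κ : ℕ} (T : Set (Fin κ → ℤ)) :
    sumsOfSquares T ⊆ nonnegOn T := by
  rintro q ⟨k, g, hg⟩ z
  rw [hg z]
  exact sum_nonneg fun j _ => Complex.zero_le_real.2 (by positivity)

/-- Density holds for every topology making `𝒫_T(𝕋^κ)` a topological vector space. -/
theorem isDenseIn_of_continuous {κ : ℕ} (T : Set (Fin κ → ℤ)) [τ : TopologicalSpace (TrigPolyOn T)]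
    [ContinuousAdd (TrigPolyOn T)] [ContinuousSMul ℂ (TrigPolyOn T)] :
    IsDenseIn τ (sumsOfSquares T) (nonnegOn T) := by
  refine ⟨sumsOfSquares_subset_nonnegOn T, fun q hq => ?_⟩
  refine mem_closure_of_tendsto (tendsto_fejerMean q) ?_
  -- A crude bound for all exponents of `q`; the extra `1` makes it strict and forces `N ≠ 0`.
  filter_upwards [eventually_ge_atTop
    (1 + ∑ α ∈ (coeff κ q.1).support, ∑ i, (α i).natAbs)] with N hN
  refine fejerMean_mem_sumsOfSquares hq (by omega) fun α hα i => ?_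
  have h1 : (α i).natAbs ≤ ∑ i, (α i).natAbs :=
    single_le_sum (f := fun i => (α i).natAbs) (fun _ _ => Nat.zero_le _) (mem_univ i)
  have h2 : ∑ i, (α i).natAbs ≤ ∑ α ∈ (coeff κ q.1).support, ∑ i, (α i).natAbs :=
    single_le_sum (f := fun α : Fin κ → ℤ => ∑ i, (α i).natAbs) (fun _ _ => Nat.zero_le _) hα
  rw [Int.abs_eq_natAbs, Nat.cast_lt]
  omega

theorem isDenseIn_seminormTopology {κ : ℕ} (T : Set (Fin κ → ℤ)) {ι : Type*} [Nonempty ι]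
    (p : ι → Seminorm ℂ (TrigPolyOn T)) :
    IsDenseIn (seminormTopology p) (sumsOfSquares T) (nonnegOn T) := by
  let := seminormTopology p
  have hp : WithSeminorms p := seminormTopology_withSeminorms p
  have : ContinuousAdd (TrigPolyOn T) := hp.topologicalAddGroup.toContinuousAdd
  have := hp.continuousSMul
  exact isDenseIn_of_continuous T

theorem norm_apply_le {κ : ℕ} (q : TrigPoly κ) (z : Torus κ) :
    ‖q.1 z‖ ≤ ∑ α ∈ (coeff κ q).support, ‖coeff κ q α‖ := by
  rw [trigPoly_apply]
  refine (norm_sum_le _ _).trans (sum_le_sum fun α _ => ?_)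
  have h : ‖∏ i, (z i : ℂ) ^ α i‖ = 1 := by
    rw [norm_prod]
    exact prod_eq_one fun i _ => by rw [norm_zpow, Circle.norm_coe, one_zpow]
  rw [norm_mul, h, mul_one]

/-- The inclusion of `𝒫_T(𝕋^κ)` into the functions with the uniform structure of uniform
convergence. -/
noncomputable def toUniformFun {κ : ℕ} (T : Set (Fin κ → ℤ)) : TrigPolyOn T →ₗ[ℂ] UniformFun (Torus κ) ℂ where
  toFun q := UniformFun.ofFun (q.1.1 : Torus κ → ℂ)
  map_add' _ _ := rfl
  map_smul' _ _ := rfl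

/-- Only continuity of scalar multiplication needs an argument: it can fail for uniform convergence
of unbounded functions, but trigonometric polynomials are bounded by `norm_apply_le`. -/
theorem isDenseIn_uniformTopology {κ : ℕ} (T : Set (Fin κ → ℤ)) :
    IsDenseIn (uniformTopology T) (sumsOfSquares T) (nonnegOn T) := by
  let := uniformTopology T
  have hi : Topology.IsInducing (toUniformFun T) := ⟨rfl⟩
  have : ContinuousAdd (TrigPolyOn T) := hi.continuousAdd (toUniformFun T)
  have : ContinuousSMul ℂ (TrigPolyOn T) := by
    refine UniformFun.continuousSMul_induced_of_range_bounded ℂ (Torus κ) ℂ (TrigPolyOn T)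
      (toUniformFun T) hi fun q => ?_
    rw [NormedSpace.isVonNBounded_iff, isBounded_iff_forall_norm_le]
    refine ⟨∑ α ∈ (coeff κ q.1).support, ‖coeff κ q.1 α‖, ?_⟩
    rintro _ ⟨z, rfl⟩
    exact norm_apply_le q.1 z
  exact isDenseIn_of_continuous T

end TrigApprox

theorem mainTheorem9 (κ : ℕ) (hκ : 0 < κ) (T : Set (Fin κ → ℤ)) (h0 : 0 ∈ T) (hT : T = -T) :
    TrigApprox.IsDenseIn (TrigApprox.finestLocallyConvex (TrigApprox.TrigPolyOn T))
      (TrigApprox.sumsOfSquares T) (TrigApprox.nonnegOn T) ∧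
    TrigApprox.IsDenseIn (TrigApprox.uniformTopology T)
      (TrigApprox.sumsOfSquares T) (TrigApprox.nonnegOn T) ∧
    TrigApprox.IsDenseIn (TrigApprox.coeffNormTopology T)
      (TrigApprox.sumsOfSquares T) (TrigApprox.nonnegOn T) := by
  exact ⟨TrigApprox.isDenseIn_seminormTopology T _, TrigApprox.isDenseIn_uniformTopology T,
    TrigApprox.isDenseIn_seminormTopology T _⟩
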